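/- Let $V$ be a set of propositional variables. Formulas of the logic $\mathcal R$Ł are built from $V$ with the connectives $\neg$, $\to$ and unary $\nabla_r$ ($r\in[0,1]$); write $\Delta_r\varphi=\neg\nabla_r\neg\varphi$ and $\varphi\leftrightarrow\psi=(\varphi\to\psi)\odot(\psi\to\varphi)$, where $\varphi\odot\psi=\neg(\varphi\to\neg\psi)$. The relation $\vdash$ is generated by modus ponens from the axioms (L1) $\varphi\to(\psi\to\varphi)$, (L2) $(\varphi\to\psi)\to((\psi\to\chi)\to(\varphi\to\chi))$, (L3) $((\varphi\to\psi)\to\psi)\to((\psi\to\varphi)\to\varphi)$, (L4) $(\neg\psi\to\neg\varphi)\to(\varphi\to\psi)$, (R1) $\nabla_r(\varphi\to\psi)\leftrightarrow(\nabla_r\varphi\to\nabla_r\psi)$, (R2) $\nabla_{\max(0,r-q)}\varphi\leftrightarrow(\nabla_q\varphi\to\nabla_r\varphi)$, (R3) $\nabla_r\nabla_q\varphi\leftrightarrow\nabla_{rq}\varphi$, (R4) $\nabla_1\varphi\leftrightarrow\varphi$. The term function $f_\varphi:[0,1]^V\to[0,1]$ is given by interpreting $\neg$ as $a\mapsto 1-a$,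 $\to$ as $(a,b)\mapsto\min(1,1-a+b)$ and $\nabla_r$ as $a\mapsto 1-r(1-a)$ (so that $\Delta_r$ is $a\mapsto ra$). Let $RL$ be the Lindenbaum–Tarski algebra, i.e. the set of classes $[\varphi]$ of formulas modulo provable equivalence, ordered by $[\varphi]\le[\psi]$ iff $\vdash\varphi\to\psi$, with MV-operations $[\varphi]^*=[\neg\varphi]$, $[\varphi]\oplus[\psi]=[\neg\varphi\to\psi]$, $x\odot y=(x^*\oplus y^*)^*$, and with Chang's distance $d(x,y)=(x^*\odot y)\oplus(x\odot y^*)$. By soundness, $f_\varphi$ depends only on $[\varphi]$. Fix a theorem $\eta$ of $\mathcal R$Ł (i.e. $\vdash\eta$) and put $\eta_r=\Delta_r\eta$ for $r\in[0,1]$. **Theorem.** Let $(\varphi_n)_{n\in\mathbb N}$ be a sequence of formulas of $\mathcal R$Ł and $\varphi$ a formula of $\mathcal R$Ł. The following are equivalent: (i) $(f_{\varphi_n})_n$ converges uniformly to $f_\varphi$ on $[0,1]^V$; (ii) for every $r\in[0,1)$ there is $k$ such that $\vdash\eta_r\to(\varphi\leftrightarrow\varphi_n)$ for all $n\ge k$;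 (iii) there is a decreasing sequence $([\psi_n])_n$ in $RL$ such that $\inf_n f_{\psi_n}(x)=0$ for every $x\in[0,1]^V$ and $d([\varphi_n],[\varphi])\le[\psi_n]$ for all $n$; (iv) there is an increasing sequence $(r_n)_n$ in $[0,1]$ with $\sup_n r_n=1$ and $\vdash\eta_{r_n}\to(\varphi\leftrightarrow\varphi_n)$ for all $n$. ("Increasing" and "decreasing" are meant in the weak sense.) -/

import Mathlib

open Filter
open scoped unitInterval

/-! The standard MV-algebra on the real unit interval `I = [0,1]`; the involution is
`unitInterval.symm`, `r ↦ 1 - r`. -/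

namespace StdMV

/-- Truncated sum `min (1, a + b)`. -/
noncomputable def oplus (a b : I) : I :=
  ⟨min 1 ((a : ℝ) + b), le_min zero_le_one (add_nonneg a.2.1 b.2.1), min_le_left _ _⟩

/-- Łukasiewicz conjunction `(a* ⊕ b*)*`. -/
noncomputable def odot (a b : I) : I := unitInterval.symm (oplus (unitInterval.symm a) (unitInterval.symm b))

/-- Łukasiewicz implication `a* ⊕ b`. -/
noncomputable def imp (a b : I) : I := oplus (unitInterval.symm a) b

theorem coe_oplus (a b : I) : (oplus a b : ℝ) = min 1 ((a : ℝ) + b) := rfl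

theorem coe_imp (a b : I) : (imp a b : ℝ) = min 1 (1 - (a : ℝ) + b) := rfl

theorem coe_odot (a b : I) : (odot a b : ℝ) = 1 - min 1 ((1 - (a : ℝ)) + (1 - b)) := rfl

theorem imp_eq_one_iff (a b : I) : imp a b = 1 ↔ a ≤ b := by
  rw [← Subtype.coe_le_coe, Subtype.ext_iff, coe_imp, Set.Icc.coe_one, min_eq_left_iff]
  constructor <;> intro h <;> linarith

end StdMV

/-- Formulas of the logic of Riesz MV-algebras over a set `V` of propositional variables:
the connectives are negation, implication and a unary `∇ r` for each real `r ∈ [0,1]`. -/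
inductive RLForm (V : Type*) : Type _
  | var : V → RLForm V
  | neg : RLForm V → RLForm V
  | imp : RLForm V → RLForm V → RLForm V
  | nabla : I → RLForm V → RLForm V

namespace RLForm

variable {V : Type*}

/-- Łukasiewicz (strong) conjunction. -/
def conj (φ ψ : RLForm V) : RLForm V := neg (imp φ (neg ψ))

/-- Equivalence `φ ↔ ψ`. -/
def biimp (φ ψ : RLForm V) : RLForm V := conj (imp φ ψ) (imp ψ φ)

/-- `Δ r φ = ¬ ∇ r ¬ φ`. -/
def delta (r : I) (φ : RLForm V) : RLForm V := neg (nabla r (neg φ))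

/-- Theorems of the logic: axioms (L1)-(L4) of Łukasiewicz logic, (R1)-(R4), and modus ponens. -/
inductive Provable : RLForm V → Prop
  | l1 (φ ψ) : Provable (imp φ (imp ψ φ))
  | l2 (φ ψ χ) : Provable (imp (imp φ ψ) (imp (imp ψ χ) (imp φ χ)))
  | l3 (φ ψ) : Provable (imp (imp (imp φ ψ) ψ) (imp (imp ψ φ) φ))
  | l4 (φ ψ) : Provable (imp (imp (neg ψ) (neg φ)) (imp φ ψ))
  | r1 (r : I) (φ ψ) : Provable (biimp (nabla r (imp φ ψ)) (imp (nabla r φ) (nabla r ψ)))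
  | r2 (r q : I) (φ) :
      Provable (biimp (nabla (StdMV.odot r (unitInterval.symm q)) φ) (imp (nabla q φ) (nabla r φ)))
  | r3 (r q : I) (φ) : Provable (biimp (nabla r (nabla q φ)) (nabla (r * q) φ))
  | r4 (φ) : Provable (biimp (nabla 1 φ) φ)
  | mp {φ ψ} : Provable (imp φ ψ) → Provable φ → Provable ψ

/-- The evaluation in the standard Riesz MV-algebra `[0,1]` that extends `e : V → [0,1]`. Since
`Δ r` is multiplication by `r` and `∇ r φ` is `¬ Δ r ¬ φ`, `∇ r` is interpreted by
`a ↦ (r a*)*`. -/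
noncomputable def eval (e : V → I) : RLForm V → I
  | var v => e v
  | neg φ => unitInterval.symm (eval e φ)
  | imp φ ψ => StdMV.imp (eval e φ) (eval e ψ)
  | nabla r φ => unitInterval.symm (r * unitInterval.symm (eval e φ))

/-- The term function `f_φ : [0,1]^V → [0,1]`. -/
noncomputable def termFun (φ : RLForm V) : (V → I) → I := fun e => eval e φ

/-! Soundness and congruence facts, needed for the Lindenbaum-Tarski algebra. -/

theorem eval_biimp_eq_one {e : V → I} {φ ψ : RLForm V} (h : eval e φ = eval e ψ) :
    eval e (biimp φ ψ) = 1 := by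
  have h1 : StdMV.imp (eval e ψ) (eval e ψ) = 1 := (StdMV.imp_eq_one_iff _ _).2 le_rfl
  apply Subtype.ext
  simp only [biimp, conj, eval, h, h1, unitInterval.coe_symm_eq, StdMV.coe_imp]
  norm_num

theorem Provable.eval_eq_one {φ : RLForm V} (h : Provable φ) (e : V → I) : eval e φ = 1 := by
  induction h with
  | l1 φ ψ =>
    simp only [eval, StdMV.imp_eq_one_iff, ← Subtype.coe_le_coe, StdMV.coe_imp]
    have h1 := (eval e ψ).2.2
    have h2 := (eval e φ).2.2
    rw [le_min_iff]
    constructor <;> linarith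
  | l2 φ ψ χ =>
    simp only [eval, StdMV.imp_eq_one_iff, ← Subtype.coe_le_coe, StdMV.coe_imp]
    rcases min_cases (1 : ℝ) (1 - (eval e φ : ℝ) + (eval e ψ : ℝ)) with h1 | h1 <;>
    rcases min_cases (1 : ℝ) (1 - (eval e ψ : ℝ) + (eval e χ : ℝ)) with h2 | h2 <;>
    rcases min_cases (1 : ℝ) (1 - (eval e φ : ℝ) + (eval e χ : ℝ)) with h3 | h3 <;>
    rw [h1.1, h2.1, h3.1, le_min_iff] <;> constructor <;> linarith
  | l3 φ ψ =>
    simp only [eval, StdMV.imp_eq_one_iff, ← Subtype.coe_le_coe, StdMV.coe_imp]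
    have h0 := (eval e ψ).2.2
    have h0' := (eval e φ).2.2
    rcases min_cases (1 : ℝ) (1 - (eval e φ : ℝ) + (eval e ψ : ℝ)) with h1 | h1 <;>
    rcases min_cases (1 : ℝ) (1 - (eval e ψ : ℝ) + (eval e φ : ℝ)) with h2 | h2 <;>
    rw [h1.1, h2.1, le_min_iff] <;> constructor <;> rw [min_le_iff] <;>
    first | (left; linarith) | (right; linarith)
  | l4 φ ψ =>
    simp only [eval, StdMV.imp_eq_one_iff, ← Subtype.coe_le_coe, StdMV.coe_imp,
      unitInterval.coe_symm_eq]
    apply min_le_min le_rfl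
    linarith
  | r1 r φ ψ =>
    apply eval_biimp_eq_one
    apply Subtype.ext
    simp only [eval, StdMV.coe_imp, unitInterval.coe_symm_eq, Set.Icc.coe_mul]
    have hr := r.2.1
    rcases le_total (eval e φ : ℝ) (eval e ψ : ℝ) with h | h
    · rw [min_eq_left (by linarith), min_eq_left (by nlinarith)]; ring
    · rw [min_eq_right (by linarith), min_eq_right (by nlinarith)]; ring
  | r2 r q φ =>
    apply eval_biimp_eq_one
    apply Subtype.ext
    simp only [eval, StdMV.coe_imp, StdMV.coe_odot, unitInterval.coe_symm_eq, Set.Icc.coe_mul]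
    have ha := (eval e φ).2.2
    rcases le_total (r : ℝ) (q : ℝ) with h | h
    · rw [min_eq_left (by linarith), min_eq_left (by nlinarith)]; ring
    · rw [min_eq_right (by linarith), min_eq_right (by nlinarith)]; ring
  | r3 r q φ =>
    apply eval_biimp_eq_one
    apply Subtype.ext
    simp only [eval, unitInterval.coe_symm_eq, Set.Icc.coe_mul]
    ring
  | r4 φ =>
    apply eval_biimp_eq_one
    simp [eval]
  | mp _ _ ih1 ih2 =>
    simp only [eval, StdMV.imp_eq_one_iff, ih2] at ih1
    exact le_antisymm unitInterval.le_one' ih1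

theorem Provable.eval_le {φ ψ : RLForm V} (h : Provable (imp φ ψ)) (e : V → I) :
    eval e φ ≤ eval e ψ := (StdMV.imp_eq_one_iff _ _).1 (h.eval_eq_one e)

theorem Provable.trans {φ ψ χ : RLForm V} (h1 : Provable (imp φ ψ)) (h2 : Provable (imp ψ χ)) :
    Provable (imp φ χ) := .mp (.mp (.l2 _ _ _) h1) h2

theorem Provable.assertion (φ ψ : RLForm V) : Provable (imp φ (imp (imp φ ψ) ψ)) :=
  .trans (.l1 φ (imp ψ φ)) (.l3 ψ φ)

theorem Provable.refl (φ : RLForm V) : Provable (imp φ φ) :=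
  .trans (.l1 φ (imp φ (imp φ φ))) (.mp (.assertion _ φ) (.l1 φ φ))

theorem Provable.exchange {φ ψ χ : RLForm V} (h : Provable (imp φ (imp ψ χ))) :
    Provable (imp ψ (imp φ χ)) :=
  .trans (.assertion ψ χ) (.mp (.l2 _ _ _) h)

theorem Provable.imp_mono {φ φ' ψ ψ' : RLForm V} (h1 : Provable (imp φ' φ))
    (h2 : Provable (imp ψ ψ')) : Provable (imp (imp φ ψ) (imp φ' ψ')) :=
  .trans (.mp (.l2 _ _ _) h1) (.mp (.exchange (.l2 _ _ _)) h2)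

theorem Provable.dne (φ : RLForm V) : Provable (imp (neg (neg φ)) φ) :=
  .trans (.trans (.l1 _ (neg (neg (imp φ φ)))) (.trans (.l4 _ _) (.l4 _ _)))
    (.mp (.assertion _ φ) (.refl φ))

theorem Provable.dni (φ : RLForm V) : Provable (imp φ (neg (neg φ))) :=
  .mp (.l4 _ _) (.dne (neg φ))

theorem Provable.contra {φ ψ : RLForm V} (h : Provable (imp φ ψ)) :
    Provable (imp (neg ψ) (neg φ)) :=
  .mp (.l4 _ _) (.trans (.dne φ) (.trans h (.dni ψ)))

/-- Provable equivalence of formulas. -/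
def provSetoid (V : Type*) : Setoid (RLForm V) where
  r φ ψ := Provable (imp φ ψ) ∧ Provable (imp ψ φ)
  iseqv := ⟨fun φ => ⟨.refl φ, .refl φ⟩, fun h => ⟨h.2, h.1⟩,
    fun h1 h2 => ⟨.trans h1.1 h2.1, .trans h2.2 h1.2⟩⟩

end RLForm

/-- The Lindenbaum-Tarski algebra of the logic, with variables in `V`. -/
def RLAlg (V : Type*) : Type _ := Quotient (RLForm.provSetoid V)

namespace RLAlg

variable {V : Type*}

/-- The class `[φ]` of a formula. -/
def mk (φ : RLForm V) : RLAlg V := Quotient.mk (RLForm.provSetoid V) φ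

/-- The MV-algebra involution `[φ]* = [¬ φ]`. -/
def compl (x : RLAlg V) : RLAlg V :=
  Quotient.map (sa := RLForm.provSetoid V) (sb := RLForm.provSetoid V) RLForm.neg
    (fun _ _ h => ⟨h.2.contra, h.1.contra⟩) x

/-- The MV-algebra sum `[φ] ⊕ [ψ] = [¬ φ → ψ]`. -/
def oplus (x y : RLAlg V) : RLAlg V :=
  Quotient.map₂ (sa := RLForm.provSetoid V) (sb := RLForm.provSetoid V)
    (sc := RLForm.provSetoid V) (fun φ ψ => RLForm.imp (RLForm.neg φ) ψ)
    (fun _ _ h _ _ k => ⟨.imp_mono h.1.contra k.1, .imp_mono h.2.contra k.2⟩) x y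

/-- `x ⊙ y = (x* ⊕ y*)*`. -/
def odot (x y : RLAlg V) : RLAlg V := compl (oplus (compl x) (compl y))

/-- Chang's distance `d(x,y) = (x* ⊙ y) ⊕ (x ⊙ y*)`. -/
def dist (x y : RLAlg V) : RLAlg V := oplus (odot (compl x) y) (odot x (compl y))

/-- The order of the algebra: `[φ] ≤ [ψ]` iff `φ → ψ` is a theorem. -/
instance instPartialOrder : PartialOrder (RLAlg V) where
  le x y := Quotient.liftOn₂ (s₁ := RLForm.provSetoid V) (s₂ := RLForm.provSetoid V) x y
    (fun φ ψ => RLForm.Provable (RLForm.imp φ ψ))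
    (fun _ _ _ _ h k => propext
      ⟨fun p => .trans h.2 (.trans p k.1), fun p => .trans h.1 (.trans p k.2)⟩)
  le_refl x := by
    induction x using Quotient.ind
    exact RLForm.Provable.refl _
  le_trans x y z := by
    induction x using Quotient.ind
    induction y using Quotient.ind
    induction z using Quotient.ind
    exact fun h k => RLForm.Provable.trans h k
  le_antisymm x y := by
    induction x using Quotient.ind
    induction y using Quotient.ind
    exact fun h k => Quotient.sound ⟨h, k⟩

/-- The function `[0,1]^V → [0,1]` of an element of the algebra: `[φ]` goes to `f_φ`. -/
noncomputable def toFun (x : RLAlg V) : (V → I) → I :=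
  Quotient.liftOn (s := RLForm.provSetoid V) x RLForm.termFun
    (fun _ _ h => funext fun e => le_antisymm (h.1.eval_le e) (h.2.eval_le e))

end RLAlg

/-! The step from semantics to proofs, (i) ⇒ (ii), needs only approximate completeness: if `f_φ > r`
everywhere, then `⊢ η_r → φ` (`Provable.delta_imp_of_lt_eval`). The argument is Pavelka's. If `η_r →
φ` is unprovable, Zorn's lemma and prelinearity give a theory `T` that omits it and decides the
order of formulas (`exists_isTheory_total`). Comparison with the constants `η_a` gives each formula
a truth value in `T`. These values respect the connectives, so they form an evaluation. Since `φ`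
has value above `r`, some `η_a → φ` with `a > r` lies in `T`; so does `φ → η_r`, by totality. Hence
`T` contains the constant `η_{a → r}`, with index below 1, and powers of it force inconsistency.

The rest is elementary: (ii) ⇒ (iv) chooses `r_n` diagonally, (iv) ⇒ (iii) takes `ψ_n = ¬η_{r_n}`,
and (iii) ⇒ (i) is Dini's theorem on the compact cube, because `d` is interpreted as `|a - b|`. -/

namespace RLForm

variable {V : Type*}

/-! ### Łukasiewicz calculus and prelinearity -/

theorem Provable.neg_imp (φ ψ : RLForm V) : Provable (imp (neg φ) (imp φ ψ)) :=
  .trans (.l1 _ (neg ψ)) (.l4 _ _)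

theorem Provable.conj_left {φ ψ : RLForm V} (h : Provable (conj φ ψ)) : Provable φ :=
  .mp (.dne _) (.mp (.contra (.neg_imp φ (neg ψ))) h)

theorem Provable.conj_right {φ ψ : RLForm V} (h : Provable (conj φ ψ)) : Provable ψ :=
  .mp (.dne _) (.mp (.contra (.l1 (neg ψ) φ)) h)

theorem Provable.imp_left_comm (φ ψ χ : RLForm V) :
    Provable (imp (imp φ (imp ψ χ)) (imp ψ (imp φ χ))) :=
  .exchange (.trans (.assertion ψ χ) (.exchange (.l2 _ _ _)))

end RLForm

namespace RLAlg

open RLForm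

variable {V : Type*}

/-- The MV-algebra implication `[φ] → [ψ] = [φ → ψ]`. -/
def imp (x y : RLAlg V) : RLAlg V :=
  Quotient.map₂ (sa := provSetoid V) (sb := provSetoid V) (sc := provSetoid V) RLForm.imp
    (fun _ _ h _ _ k => ⟨.imp_mono h.2 k.1, .imp_mono h.1 k.2⟩) x y

theorem mk_neg (φ : RLForm V) : mk (neg φ) = compl (mk φ) := rfl

theorem mk_eq_mk {φ ψ : RLForm V} :
    mk φ = mk ψ ↔ Provable (RLForm.imp φ ψ) ∧ Provable (RLForm.imp ψ φ) := by
  rw [le_antisymm_iff]; rfl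

theorem mk_eq_of_biimp {φ ψ : RLForm V} (h : Provable (biimp φ ψ)) : mk φ = mk ψ :=
  mk_eq_mk.2 ⟨h.conj_left, h.conj_right⟩

theorem provable_of_mk_eq {φ ψ : RLForm V} (h : mk φ = mk ψ) (hφ : Provable φ) : Provable ψ :=
  .mp (mk_eq_mk.1 h).1 hφ

theorem ind {p : RLAlg V → Prop} (h : ∀ φ, p (mk φ)) (x : RLAlg V) : p x := Quotient.ind h x

theorem compl_compl (x : RLAlg V) : compl (compl x) = x := by
  induction x using ind
  exact mk_eq_mk.2 ⟨.dne _, .dni _⟩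

theorem imp_left_comm (x y z : RLAlg V) : imp x (imp y z) = imp y (imp x z) := by
  induction x using ind
  induction y using ind
  induction z using ind
  exact mk_eq_mk.2 ⟨.imp_left_comm _ _ _, .imp_left_comm _ _ _⟩

theorem imp_compl_compl (x y : RLAlg V) : imp (compl x) (compl y) = imp y x := by
  induction x using ind with | _ φ
  induction y using ind with | _ ψ
  exact mk_eq_mk.2 ⟨.l4 _ _, .trans (.imp_mono (.dne _) (.dni _)) (.l4 _ _)⟩

theorem imp_compl_comm (x y : RLAlg V) : imp x (compl y) = imp y (compl x) := by
  rw [← imp_compl_compl (compl y), compl_compl]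

theorem compl_imp_comm (x y : RLAlg V) : imp (compl x) y = imp (compl y) x := by
  rw [← imp_compl_compl x, compl_compl]

theorem imp_imp_comm (x y : RLAlg V) : imp (imp x y) y = imp (imp y x) x := by
  induction x using ind
  induction y using ind
  exact mk_eq_mk.2 ⟨.l3 _ _, .l3 _ _⟩

/-- The join `(x → y) ∨ (y → x)`, with its first argument moved to the front. -/
theorem imp_imp_imp_imp_eq (x y : RLAlg V) :
    imp (imp (imp y x) (imp x y)) (imp x y) =
      imp (compl x) (imp (imp (compl x) (imp y x))
        (imp (imp (compl y) (imp (imp y x) (compl x))) (imp (imp y x) (compl x)))) := by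
  set Q := imp y x with hQ
  set c := imp Q (compl x) with hc
  have h1 : imp Q (imp x y) = imp (compl y) c := by
    rw [← imp_compl_compl y x, imp_left_comm]
  have h2 : imp (imp (compl y) c) y = imp (imp y (compl c)) (compl c) := by
    rw [compl_imp_comm, imp_imp_comm]
  have h3 : imp c (compl x) = imp (imp (compl x) Q) Q := by rw [hc, imp_imp_comm]
  have h4 : imp (imp y (compl c)) (compl y) = imp (imp (compl y) c) c := by
    rw [imp_compl_comm y c, imp_imp_comm]
  -- Joins are swapped by (L3) until the conclusion `x → y` has become `Q`, that is `¬x → ¬y`; then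
  -- `¬x` can be pulled to the front.
  rw [h1, imp_left_comm, h2, imp_left_comm, imp_compl_comm x c, h3, imp_left_comm, ← h4]
  conv_lhs => rw [hQ]
  conv_lhs => arg 2; arg 2; rw [← imp_compl_compl x y]
  rw [imp_left_comm _ (compl x), imp_left_comm _ (compl x)]

theorem dist_mk_mk (φ ψ : RLForm V) : dist (mk ψ) (mk φ) = compl (mk (biimp φ ψ)) := by
  have h : dist (mk ψ) (mk φ) = imp (compl (compl (imp (compl (compl (compl (mk ψ)))) (compl (mk φ)))))
    (compl (imp (compl (compl (mk ψ))) (compl (compl (mk φ))))) := rfl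
  have h' : compl (mk (biimp φ ψ)) =
    compl (compl (imp (imp (mk φ) (mk ψ)) (compl (imp (mk ψ) (mk φ))))) := rfl
  rw [h, h']
  simp only [compl_compl, imp_compl_compl]

end RLAlg

namespace RLForm

variable {V : Type*}

/-- After the rewriting, `¬φ` implies `(ψ → φ) → ¬φ` under two extra premises, so three instances of
(L1) suffice. -/
theorem Provable.prelinear (φ ψ : RLForm V) :
    Provable (imp (imp (imp ψ φ) (imp φ ψ)) (imp φ ψ)) :=
  RLAlg.provable_of_mk_eq (RLAlg.imp_imp_imp_imp_eq (RLAlg.mk φ) (RLAlg.mk ψ)).symm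
    (φ := imp (neg φ) (imp (imp (neg φ) (imp ψ φ))
        (imp (imp (neg ψ) (imp (imp ψ φ) (neg φ))) (imp (imp ψ φ) (neg φ)))))
    (.trans (.l1 _ (imp ψ φ)) (.trans (.l1 _ _) (.l1 _ _)))

end RLForm

/-! ### The constants `η_r` -/

namespace RLAlg

open RLForm

variable {V : Type*}

theorem imp_eq_mk_of_provable {φ : RLForm V} (hφ : Provable φ) (x : RLAlg V) :
    imp (mk φ) x = x := by
  induction x using ind
  exact mk_eq_mk.2 ⟨.mp (.assertion _ _) hφ, .l1 _ _⟩

theorem imp_compl_mk_of_provable {φ : RLForm V} (hφ : Provable φ) (x : RLAlg V) :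
    imp x (compl (mk φ)) = compl x := by
  rw [imp_compl_comm, imp_eq_mk_of_provable hφ]

end RLAlg

namespace RLForm

variable {V : Type*}

open unitInterval RLAlg

theorem mk_nabla_odot (r q : I) (φ : RLForm V) :
    mk (nabla (StdMV.odot r (σ q)) φ) = RLAlg.imp (mk (nabla q φ)) (mk (nabla r φ)) :=
  mk_eq_of_biimp (.r2 r q φ)

theorem mk_nabla_one (φ : RLForm V) : mk (nabla 1 φ) = mk φ := mk_eq_of_biimp (.r4 φ)

theorem mk_nabla_symm (q : I) (φ : RLForm V) :
    mk (nabla (σ q) φ) = RLAlg.imp (mk (nabla q φ)) (mk φ) := by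
  have h : StdMV.odot 1 (σ q) = σ q := by
    ext
    rw [StdMV.coe_odot, coe_symm_eq, min_eq_right] <;> simp [q.2.2]
  rw [← mk_nabla_one φ, ← mk_nabla_odot, h]

/-- By (R2) and (R4), `∇_r φ` is `∇_{1-r} φ → φ`, so this is weakening. It serves as necessitation
and makes every theory closed under monotonicity of `∇_r`. -/
theorem Provable.imp_nabla (r : I) (φ : RLForm V) : Provable (imp φ (nabla r φ)) := by
  have h := mk_nabla_symm (σ r) φ
  rw [symm_symm] at h
  exact .trans (.l1 _ _) (mk_eq_mk.1 h).2

theorem Provable.nabla_imp (r : I) (φ ψ : RLForm V) :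
    Provable (imp (imp φ ψ) (imp (nabla r φ) (nabla r ψ))) :=
  .trans (.imp_nabla r _) (Provable.conj_left (.r1 r φ ψ))

variable {η : RLForm V}

/-- As `¬η` is falsum, `∇_r ¬η → ¬η` is a negation. With this second form of `η_r`, the axioms (R2)
and (R3) say that the connectives act on constants as on their indices. -/
theorem mk_delta (hη : Provable η) (r : I) : mk (delta r η) = mk (nabla (σ r) (neg η)) := by
  rw [mk_nabla_symm, mk_neg, imp_compl_mk_of_provable hη, delta, mk_neg]

theorem compl_mk_delta (hη : Provable η) (r : I) :
    compl (mk (delta r η)) = mk (delta (σ r) η) := by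
  rw [mk_delta hη, delta, mk_neg]

theorem imp_mk_delta (hη : Provable η) (q r : I) :
    RLAlg.imp (mk (delta q η)) (mk (delta r η)) = mk (delta (StdMV.imp q r) η) := by
  have h : σ (StdMV.imp q r) = StdMV.odot q (σ r) := by
    rw [StdMV.odot, symm_symm, StdMV.imp]
  rw [mk_delta hη (StdMV.imp q r), h, mk_nabla_odot, delta, delta, mk_neg, mk_neg,
    imp_compl_compl]

theorem Provable.delta_one (hη : Provable η) : Provable (delta 1 η) := by
  refine provable_of_mk_eq (φ := neg (neg η)) ?_ (.mp (.dni _) hη)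
  rw [delta, mk_neg, mk_neg (nabla 1 _), mk_nabla_one]

theorem mk_nabla_congr {φ ψ : RLForm V} (r : I) (h : mk φ = mk ψ) :
    mk (nabla r φ) = mk (nabla r ψ) := by
  rw [mk_eq_mk] at h ⊢
  exact ⟨.mp (.nabla_imp r φ ψ) h.1, .mp (.nabla_imp r ψ φ) h.2⟩

theorem mk_nabla_delta (hη : Provable η) (r a : I) :
    mk (nabla r (delta a η)) = mk (delta (σ (r * σ a)) η) := by
  rw [mk_nabla_congr r (mk_delta hη a), mk_eq_of_biimp (.r3 r (σ a) (neg η)), mk_delta hη,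
    symm_symm]

theorem Provable.delta_imp_delta (hη : Provable η) {q r : I} (h : q ≤ r) :
    Provable (imp (delta q η) (delta r η)) := by
  refine provable_of_mk_eq (φ := delta (StdMV.imp q r) η) (imp_mk_delta hη q r).symm ?_
  rw [(StdMV.imp_eq_one_iff _ _).2 h]
  exact .delta_one hη

theorem Provable.delta_zero_imp (hη : Provable η) (φ : RLForm V) : Provable (imp (delta 0 η) φ) := by
  have h : mk (delta 1 η) = mk (neg (delta 0 η)) := by rw [mk_neg, compl_mk_delta hη, symm_zero]
  exact .mp (.neg_imp _ _) (provable_of_mk_eq h (.delta_one hη))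

end RLForm

/-! ### Theories and total extensions -/

namespace RLForm

variable {V : Type*}

/-- A theory: a set of formulas containing the theorems and closed under modus ponens. -/
structure IsTheory (T : Set (RLForm V)) : Prop where
  of_provable {φ : RLForm V} : Provable φ → φ ∈ T
  mp {φ ψ : RLForm V} : imp φ ψ ∈ T → φ ∈ T → ψ ∈ T

/-- The iterated implication `φ → (φ → ⋯ (φ → ψ))`, with `n` premises. -/
def impIter (φ : RLForm V) : ℕ → RLForm V → RLForm V
  | 0, ψ => ψ
  | n + 1, ψ => imp φ (impIter φ n ψ)

theorem impIter_add (φ : RLForm V) (m n : ℕ) (ψ : RLForm V) :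
    impIter φ (m + n) ψ = impIter φ n (impIter φ m ψ) := by
  induction n with
  | zero => rfl
  | succ n ih => rw [← add_assoc, impIter, ih, impIter]

theorem isTheory_provable : IsTheory {φ : RLForm V | Provable φ} := ⟨id, .mp⟩

namespace IsTheory

variable {T : Set (RLForm V)} (hT : IsTheory T)
include hT

theorem trans {φ ψ χ : RLForm V} (h1 : imp φ ψ ∈ T) (h2 : imp ψ χ ∈ T) : imp φ χ ∈ T :=
  hT.mp (hT.mp (hT.of_provable (.l2 _ _ _)) h1) h2

theorem imp_mem {φ ψ : RLForm V} (h : ψ ∈ T) : imp φ ψ ∈ T := hT.mp (hT.of_provable (.l1 _ _)) h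

theorem imp_mono {φ φ' ψ ψ' : RLForm V} (h1 : imp φ' φ ∈ T) (h2 : imp ψ ψ' ∈ T) :
    imp (imp φ ψ) (imp φ' ψ') ∈ T :=
  hT.trans (hT.mp (hT.of_provable (.l2 _ _ _)) h1)
    (hT.mp (hT.of_provable (.exchange (.l2 _ _ _))) h2)

theorem contra {φ ψ : RLForm V} (h : imp φ ψ ∈ T) : imp (neg ψ) (neg φ) ∈ T :=
  hT.mp (hT.of_provable (.l4 _ _)) <|
    hT.trans (hT.of_provable (.dne φ)) (hT.trans h (hT.of_provable (.dni ψ)))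

theorem nabla_mono {φ ψ : RLForm V} (r : I) (h : imp φ ψ ∈ T) :
    imp (nabla r φ) (nabla r ψ) ∈ T :=
  hT.mp (hT.of_provable (.nabla_imp r φ ψ)) h

theorem mem_of_mk_eq {φ ψ : RLForm V} (h : RLAlg.mk φ = RLAlg.mk ψ) (hφ : φ ∈ T) : ψ ∈ T :=
  hT.mp (hT.of_provable (RLAlg.mk_eq_mk.1 h).1) hφ

/-- Reasoning by cases along prelinearity. -/
theorem mem_of_imp_mem_of_imp_mem {φ ψ χ : RLForm V} (h1 : imp (imp φ ψ) χ ∈ T)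
    (h2 : imp (imp ψ φ) χ ∈ T) : χ ∈ T := by
  -- This is the join of `χ` and `ψ → φ`; (L3) swaps it, and then `h2` leaves `χ`.
  have h3 : imp (imp χ (imp ψ φ)) (imp ψ φ) ∈ T :=
    hT.trans (hT.imp_mono h1 (hT.of_provable (.refl _))) (hT.of_provable (.prelinear ψ φ))
  exact hT.mp (hT.mp (hT.of_provable (.l3 _ _)) h3) h2

theorem impIter_imp (φ : RLForm V) (n : ℕ) (ψ χ : RLForm V) :
    imp (impIter φ n (imp ψ χ)) (imp ψ (impIter φ n χ)) ∈ T := by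
  induction n with
  | zero => exact hT.of_provable (.refl _)
  | succ n ih =>
    exact hT.trans (hT.imp_mono (hT.of_provable (.refl _)) ih)
      (hT.of_provable (.imp_left_comm _ _ _))

theorem imp_impIter (φ : RLForm V) (n : ℕ) (ψ : RLForm V) : imp ψ (impIter φ n ψ) ∈ T := by
  induction n with
  | zero => exact hT.of_provable (.refl _)
  | succ n ih => exact hT.trans ih (hT.of_provable (.l1 _ _))

theorem impIter_mono (φ : RLForm V) (n : ℕ) {ψ χ : RLForm V} (h : imp ψ χ ∈ T) :
    imp (impIter φ n ψ) (impIter φ n χ) ∈ T := by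
  induction n with
  | zero => exact h
  | succ n ih => exact hT.imp_mono (hT.of_provable (.refl _)) ih

/-- Without contraction, uses of a hypothesis are counted. One copy is removed at a time, by cases
with the remaining iterated implication as conclusion. -/
theorem mem_of_imp_mem_of_impIter_mem {φ ψ χ : RLForm V} (h1 : imp (imp φ ψ) χ ∈ T) {n : ℕ}
    (h2 : impIter (imp ψ φ) n χ ∈ T) : χ ∈ T := by
  induction n with
  | zero => exact h2
  | succ n ih => exact ih (hT.mem_of_imp_mem_of_imp_mem (hT.trans h1 (hT.imp_impIter _ n χ)) h2)

theorem mem_of_impIter_mem_of_impIter_mem {φ ψ χ : RLForm V} {m n : ℕ}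
    (h1 : impIter (imp φ ψ) m χ ∈ T) (h2 : impIter (imp ψ φ) n χ ∈ T) : χ ∈ T := by
  induction m with
  | zero => exact h1
  | succ m ih =>
    exact ih (hT.mem_of_imp_mem_of_impIter_mem h1
      (hT.mp (hT.impIter_mono _ n (hT.imp_impIter _ m χ)) h2))

/-- The theory generated by `T` and `φ`. -/
theorem adjoin (φ : RLForm V) : IsTheory {ψ | ∃ n, impIter φ n ψ ∈ T} where
  of_provable h := ⟨0, hT.of_provable h⟩
  mp := by
    rintro ψ χ ⟨m, hm⟩ ⟨n, hn⟩
    refine ⟨m + n, ?_⟩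
    rw [impIter_add]
    exact hT.mp (hT.impIter_mono φ n (hT.mp (hT.impIter_imp φ m ψ χ) hm)) hn

end IsTheory

/-- A formula that is not a theorem is omitted by a theory that decides the order of formulas. -/
theorem exists_isTheory_total {χ : RLForm V} (hχ : ¬ Provable χ) :
    ∃ T : Set (RLForm V), IsTheory T ∧ χ ∉ T ∧ ∀ φ ψ, imp φ ψ ∈ T ∨ imp ψ φ ∈ T := by
  have hub (c : Set (Set (RLForm V))) (hc : c ⊆ {T | IsTheory T ∧ χ ∉ T})
      (hchain : IsChain (· ⊆ ·) c) (hne : c.Nonempty) :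
      ∃ ub ∈ {T : Set (RLForm V) | IsTheory T ∧ χ ∉ T}, ∀ s ∈ c, s ⊆ ub := by
    obtain ⟨T₀, hT₀⟩ := hne
    refine ⟨⋃₀ c, ⟨⟨fun h => ⟨T₀, hT₀, (hc hT₀).1.of_provable h⟩, ?_⟩, ?_⟩,
      fun _ => Set.subset_sUnion_of_mem⟩
    · rintro φ ψ ⟨A, hA, hφ⟩ ⟨B, hB, hψ⟩
      rcases hchain.total hA hB with h | h
      · exact ⟨B, hB, (hc hB).1.mp (h hφ) hψ⟩
      · exact ⟨A, hA, (hc hA).1.mp hφ (h hψ)⟩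
    · rintro ⟨A, hA, h⟩
      exact (hc hA).2 h
  obtain ⟨T, -, hT⟩ := zorn_subset_nonempty _ hub {φ | Provable φ} ⟨isTheory_provable, hχ⟩
  -- Otherwise adjoining `α` would still omit `χ`, against maximality.
  have key (α : RLForm V) (hα : α ∉ T) : ∃ n, impIter α n χ ∈ T := by
    by_contra h
    refine hα (hT.2 ⟨hT.1.1.adjoin α, h⟩ (fun ψ hψ => ⟨0, hψ⟩) ⟨1, ?_⟩)
    exact hT.1.1.of_provable (.refl α)
  refine ⟨T, hT.1.1, hT.1.2, fun φ ψ => ?_⟩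
  by_contra! h
  obtain ⟨m, hm⟩ := key _ h.1
  obtain ⟨n, hn⟩ := key _ h.2
  exact hT.1.2 (hT.1.1.mem_of_impIter_mem_of_impIter_mem hm hn)

end RLForm

/-! ### Truth values and approximate completeness -/

namespace RLForm

open unitInterval RLAlg

variable {V : Type*} {T : Set (RLForm V)} {η : RLForm V}

/-- In the theory `T`, the formula `φ` has the truth value `v`, up to arbitrarily small errors. -/
def HasValue (T : Set (RLForm V)) (η φ : RLForm V) (v : I) : Prop :=
  ∀ ε > (0 : ℝ), (∃ a : I, (v : ℝ) - ε ≤ a ∧ imp (delta a η) φ ∈ T) ∧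
    ∃ b : I, (b : ℝ) ≤ v + ε ∧ imp φ (delta b η) ∈ T

theorem HasValue.neg (hT : IsTheory T) (hη : Provable η) {φ : RLForm V} {v : I}
    (h : HasValue T η φ v) : HasValue T η (neg φ) (σ v) := by
  intro ε hε
  obtain ⟨⟨a, ha, haT⟩, b, hb, hbT⟩ := h ε hε
  refine ⟨⟨σ b, ?_, ?_⟩, σ a, ?_, ?_⟩
  · rw [coe_symm_eq, coe_symm_eq]; linarith
  · exact hT.trans (hT.of_provable (mk_eq_mk.1 (compl_mk_delta hη b)).2) (hT.contra hbT)
  · rw [coe_symm_eq, coe_symm_eq]; linarith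
  · exact hT.trans (hT.contra haT) (hT.of_provable (mk_eq_mk.1 (compl_mk_delta hη a)).1)

theorem HasValue.imp (hT : IsTheory T) (hη : Provable η) {φ ψ : RLForm V} {v w : I}
    (h : HasValue T η φ v) (k : HasValue T η ψ w) :
    HasValue T η (imp φ ψ) (StdMV.imp v w) := by
  intro ε hε
  obtain ⟨⟨a, ha, haT⟩, b, hb, hbT⟩ := h (ε / 2) (half_pos hε)
  obtain ⟨⟨c, hc, hcT⟩, d, hd, hdT⟩ := k (ε / 2) (half_pos hε)
  refine ⟨⟨StdMV.imp b c, ?_, ?_⟩, StdMV.imp a d, ?_, ?_⟩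
  · rw [StdMV.coe_imp, StdMV.coe_imp, sub_le_iff_le_add, ← min_add_add_right]
    exact min_le_min (by linarith) (by linarith)
  · exact hT.trans (hT.of_provable (mk_eq_mk.1 (imp_mk_delta hη b c)).2) (hT.imp_mono hbT hcT)
  · rw [StdMV.coe_imp, StdMV.coe_imp, ← min_add_add_right]
    exact min_le_min (by linarith) (by linarith)
  · exact hT.trans (hT.imp_mono haT hdT) (hT.of_provable (mk_eq_mk.1 (imp_mk_delta hη a d)).1)

theorem HasValue.nabla (hT : IsTheory T) (hη : Provable η) (r : I) {φ : RLForm V} {v : I}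
    (h : HasValue T η φ v) : HasValue T η (nabla r φ) (σ (r * σ v)) := by
  have key {x y : I} {ε : ℝ} (hε : 0 < ε) (hxy : (x : ℝ) - ε ≤ y) :
      (σ (r * σ x) : ℝ) - ε ≤ σ (r * σ y) := by
    simp only [coe_symm_eq, Set.Icc.coe_mul]
    nlinarith [r.2.1, r.2.2, mul_nonneg r.2.1 (sub_nonneg.2 hxy),
      mul_nonneg (sub_nonneg.2 r.2.2) hε.le]
  intro ε hε
  obtain ⟨⟨a, ha, haT⟩, b, hb, hbT⟩ := h ε hε
  refine ⟨⟨σ (r * σ a), key hε ha, ?_⟩, σ (r * σ b), ?_, ?_⟩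
  · exact hT.trans (hT.of_provable (mk_eq_mk.1 (mk_nabla_delta hη r a)).2) (hT.nabla_mono r haT)
  · linarith [key hε (show (b : ℝ) - ε ≤ v by linarith)]
  · exact hT.trans (hT.nabla_mono r hbT) (hT.of_provable (mk_eq_mk.1 (mk_nabla_delta hη r b)).1)

theorem HasValue.eval (hT : IsTheory T) (hη : Provable η) {e : V → I}
    (he : ∀ x, HasValue T η (var x) (e x)) (φ : RLForm V) : HasValue T η φ (eval e φ) := by
  induction φ with
  | var x => exact he x
  | neg φ ih => exact ih.neg hT hη
  | imp φ ψ ih ih' => exact ih.imp hT hη ih'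
  | nabla r φ ih => exact ih.nabla hT hη r

/-- The value is the supremum of the `r` with `η_r → φ` in `T`. It need not be attained, hence the
errors `ε`; above it, totality reverses the implication. -/
theorem exists_hasValue (hT : IsTheory T) (htot : ∀ φ ψ, RLForm.imp φ ψ ∈ T ∨ RLForm.imp ψ φ ∈ T)
    (hη : Provable η) (φ : RLForm V) : ∃ v, HasValue T η φ v := by
  set S : Set I := {r | RLForm.imp (delta r η) φ ∈ T}
  have h0 : (0 : I) ∈ S := hT.of_provable (.delta_zero_imp hη φ)
  obtain ⟨v, hv⟩ : ∃ v, IsLUB S v := ⟨_, isLUB_sSup S⟩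
  refine ⟨v, fun ε hε => ⟨?_, ?_⟩⟩
  · rcases le_or_gt (v : ℝ) ε with h | h
    · exact ⟨0, by simpa using h, h0⟩
    · have hmem : (v : ℝ) - ε ∈ I := ⟨by linarith, by linarith [v.2.2]⟩
      obtain ⟨a, ha, hlt, -⟩ := hv.exists_between
        (show (⟨_, hmem⟩ : I) < v from Subtype.coe_lt_coe.1 (by simpa using hε))
      exact ⟨a, (Subtype.coe_lt_coe.2 hlt).le, ha⟩
  · rcases le_or_gt 1 ((v : ℝ) + ε) with h | h
    · exact ⟨1, by simpa using h, hT.imp_mem (hT.of_provable (.delta_one hη))⟩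
    · have hmem : (v : ℝ) + ε ∈ I := ⟨by linarith [v.2.1], h.le⟩
      refine ⟨⟨_, hmem⟩, le_rfl, (htot _ _).resolve_right fun hS => ?_⟩
      have : (v : ℝ) + ε ≤ v := Subtype.coe_le_coe.2 (hv.1 hS)
      linarith

/-- A consistent theory contains no constant `η_r` with `r < 1`. -/
theorem IsTheory.delta_notMem (hT : IsTheory T) (hη : Provable η) {χ : RLForm V} (hχ : χ ∉ T)
    {r : I} (hr : r < 1) : delta r η ∉ T := by
  intro h
  -- Since `η_r → η_s` is `η_{r → s}`, each modus ponens with `η_r` lowers the reachable index by `1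
  -- - r`, eventually to `0`.
  have key (n : ℕ) : ∀ s : I, 1 - n * (1 - (r : ℝ)) ≤ s → delta s η ∈ T := by
    induction n with
    | zero =>
      intro s hs
      have : s = 1 := le_antisymm le_one' (Subtype.coe_le_coe.1 (by simpa using hs))
      exact this ▸ hT.of_provable (.delta_one hη)
    | succ n ih =>
      intro s hs
      refine hT.mp (φ := delta r η) ?_ h
      refine hT.mem_of_mk_eq (imp_mk_delta hη r s).symm (ih _ ?_)
      rw [StdMV.coe_imp, le_min_iff]
      push_cast at hs
      have : (0 : ℝ) ≤ n * (1 - (r : ℝ)) := mul_nonneg n.cast_nonneg (by linarith [r.2.2])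
      constructor <;> linarith
  have hr' : 0 < 1 - (r : ℝ) := sub_pos.2 (Subtype.coe_lt_coe.2 hr)
  obtain ⟨n, hn⟩ := exists_nat_gt (1 / (1 - (r : ℝ)))
  rw [div_lt_iff₀ hr'] at hn
  exact hχ (hT.mp (hT.of_provable (.delta_zero_imp hη χ)) (key n 0 (by simpa using hn.le)))

/-- Completeness up to an arbitrarily small error in the truth value. -/
theorem Provable.delta_imp_of_lt_eval (hη : Provable η) {r : I} {φ : RLForm V}
    (h : ∀ e : V → I, r < RLForm.eval e φ) : Provable (RLForm.imp (delta r η) φ) := by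
  by_contra hχ
  obtain ⟨T, hT, hχT, htot⟩ := exists_isTheory_total hχ
  choose e he using fun x : V => exists_hasValue hT htot hη (var x)
  have hlt : (r : ℝ) < RLForm.eval e φ := Subtype.coe_lt_coe.2 (h e)
  -- Half the gap as error keeps `a` strictly above `r`.
  obtain ⟨⟨a, ha, haT⟩, -⟩ := HasValue.eval hT hη he φ (((RLForm.eval e φ : ℝ) - r) / 2)
    (by linarith)
  have hra := hT.mem_of_mk_eq (imp_mk_delta hη a r) (hT.trans haT ((htot _ _).resolve_left hχT))
  refine hT.delta_notMem hη hχT (lt_of_le_of_ne le_one' fun h1 => ?_) hra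
  rw [StdMV.imp_eq_one_iff, ← Subtype.coe_le_coe] at h1
  linarith

/-! ### Term functions -/

theorem coe_eval_biimp (e : V → I) (φ ψ : RLForm V) :
    (RLForm.eval e (biimp φ ψ) : ℝ) = 1 - |(RLForm.eval e φ : ℝ) - RLForm.eval e ψ| := by
  have h1 := (RLForm.eval e φ).2
  have h2 := (RLForm.eval e ψ).2
  simp only [biimp, conj, RLForm.eval, coe_symm_eq, StdMV.coe_imp]
  generalize (RLForm.eval e φ : ℝ) = a at *
  generalize (RLForm.eval e ψ : ℝ) = b at *
  rcases le_total a b with h | h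
  · rw [abs_of_nonpos (by linarith), min_eq_left (by linarith : 1 ≤ 1 - a + b),
      min_eq_right (by linarith : 1 - b + a ≤ 1), min_eq_right (by linarith [h1.1, h2.2])]
    ring
  · rw [abs_of_nonneg (by linarith), min_eq_right (by linarith : 1 - a + b ≤ 1),
      min_eq_left (by linarith : 1 ≤ 1 - b + a), min_eq_right (by linarith [h1.2, h2.1])]
    ring

theorem eval_delta_of_provable (hη : Provable η) (r : I) (e : V → I) :
    RLForm.eval e (delta r η) = r := by
  simp [delta, RLForm.eval, hη.eval_eq_one e]

theorem continuous_termFun (φ : RLForm V) : Continuous (termFun φ) := by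
  have hc : Continuous fun p : I × I => StdMV.imp p.1 p.2 := by
    refine Continuous.subtype_mk (continuous_const.min ?_) _
    fun_prop
  induction φ with
  | var x => exact continuous_apply x
  | neg φ ih => exact continuous_symm.comp ih
  | imp φ ψ ih ih' => exact hc.comp (ih.prodMk ih')
  | nabla r φ ih => exact continuous_symm.comp (continuous_const.mul (continuous_symm.comp ih))

end RLForm

theorem RLAlg.continuous_toFun {V : Type*} (x : RLAlg V) : Continuous x.toFun := by
  induction x using RLAlg.ind with | _ φ
  exact RLForm.continuous_termFun φ

theorem RLAlg.toFun_mono {V : Type*} : Monotone (RLAlg.toFun (V := V)) := by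
  intro x y h
  induction x using RLAlg.ind
  induction y using RLAlg.ind
  exact fun e => RLForm.Provable.eval_le h e

/-! ### The equivalences -/

open RLForm unitInterval in
theorem mainTheorem1 {V : Type*} (η : RLForm V) (hη : RLForm.Provable η)
    (φs : ℕ → RLForm V) (φ : RLForm V) :
    List.TFAE [
      TendstoUniformly (fun n => RLForm.termFun (φs n)) (RLForm.termFun φ) atTop,
      ∀ r : I, r < 1 → ∃ k : ℕ, ∀ n ≥ k,
        RLForm.Provable (RLForm.imp (RLForm.delta r η) (RLForm.biimp φ (φs n))),
      ∃ ψ : ℕ → RLAlg V, Antitone ψ ∧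
        (∀ x : V → I, IsGLB (Set.range fun n => (ψ n).toFun x) 0) ∧
        ∀ n, RLAlg.dist (RLAlg.mk (φs n)) (RLAlg.mk φ) ≤ ψ n,
      ∃ r : ℕ → I, Monotone r ∧ IsLUB (Set.range r) 1 ∧
        ∀ n, RLForm.Provable (RLForm.imp (RLForm.delta (r n) η) (RLForm.biimp φ (φs n)))] := by
  tfae_have 1 → 2 := by
    intro h r hr
    rw [Metric.tendstoUniformly_iff] at h
    obtain ⟨k, hk⟩ := eventually_atTop.1 (h (1 - r) (sub_pos.2 (Subtype.coe_lt_coe.2 hr)))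
    refine ⟨k, fun n hn => .delta_imp_of_lt_eval hη fun e => ?_⟩
    have := hk n hn e
    rw [Subtype.dist_eq, Real.dist_eq] at this
    rw [← Subtype.coe_lt_coe, coe_eval_biimp]
    simp only [termFun] at this
    linarith
  tfae_have 2 → 4 := by
    classical
    intro h
    have hs (m : ℕ) : 1 - 1 / ((m : ℝ) + 1) ∈ I := by
      have h1 : (0 : ℝ) < m + 1 := by positivity
      have h2 : 1 / ((m : ℝ) + 1) ≤ 1 := by rw [div_le_one h1]; linarith [m.cast_nonneg (α := ℝ)]
      exact ⟨by linarith, by linarith [one_div_pos.2 h1]⟩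
    set s : ℕ → I := fun m => ⟨_, hs m⟩ with hs_def
    have hs1 (m : ℕ) : s m < 1 := by
      rw [← Subtype.coe_lt_coe]
      have : (0 : ℝ) < 1 / ((m : ℝ) + 1) := by positivity
      change 1 - 1 / ((m : ℝ) + 1) < 1
      linarith
    -- `F n` collects the `m ≤ n` for which `s m` works from `n` on. It grows with `n` and
    -- eventually contains each `m`, so `r_n = max s` over `F n` increases to 1.
    set F : ℕ → Finset ℕ := fun n => (Finset.range (n + 1)).filter fun m =>
      ∀ n' ≥ n, Provable (imp (delta (s m) η) (biimp φ (φs n'))) with hF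
    refine ⟨fun n => (F n).sup s, fun m n hmn => Finset.sup_mono fun i hi => ?_, ?_, fun n => ?_⟩
    · simp only [hF, Finset.mem_filter, Finset.mem_range] at hi ⊢
      exact ⟨by lia, fun n' hn' => hi.2 n' (hmn.trans hn')⟩
    · refine ⟨fun _ _ => le_one', fun u hu => ?_⟩
      rw [← Subtype.coe_le_coe]
      refine le_of_forall_pos_sub_le fun ε hε => ?_
      obtain ⟨m, hm⟩ := exists_nat_one_div_lt hε
      obtain ⟨k, hk⟩ := h (s m) (hs1 m)
      have h1 : s m ≤ (F (max m k)).sup s := by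
        refine Finset.le_sup ?_
        simp only [hF, Finset.mem_filter, Finset.mem_range]
        exact ⟨by lia, fun n' hn' => hk n' ((le_max_right _ _).trans hn')⟩
      have h2 : 1 - 1 / ((m : ℝ) + 1) ≤ u := Subtype.coe_le_coe.2 (h1.trans (hu ⟨_, rfl⟩))
      rw [Set.Icc.coe_one]
      linarith
    -- `s 0 = 0` always works because `η_0` implies everything; thus `F n` is nonempty and its
    -- supremum is attained.
    · have h0 : 0 ∈ F n := by
        simp only [hF, Finset.mem_filter, Finset.mem_range]
        have : s 0 = 0 := Subtype.ext (by simp [hs_def])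
        exact ⟨by lia, fun n' _ => this ▸ .delta_zero_imp hη _⟩
      obtain ⟨m, hm, hsup⟩ := Finset.exists_mem_eq_sup (F n) ⟨0, h0⟩ s
      simp only [hsup]
      exact (Finset.mem_filter.1 hm).2 n le_rfl
  tfae_have 4 → 3 := by
    rintro ⟨r, hmono, hlub, hr⟩
    refine ⟨fun n => RLAlg.mk (neg (delta (r n) η)), fun m n hmn => ?_, fun x => ?_, fun n => ?_⟩
    · exact (Provable.delta_imp_delta hη (hmono hmn)).contra
    · have h (n : ℕ) : (RLAlg.mk (neg (delta (r n) η))).toFun x = σ (r n) :=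
        congrArg σ (eval_delta_of_provable hη (r n) x)
      simp only [h]
      refine ⟨fun _ _ => nonneg', fun u hu => ?_⟩
      have : 1 ≤ σ u := hlub.2 (by
        rintro _ ⟨n, rfl⟩
        exact le_symm_comm.1 (hu ⟨n, rfl⟩))
      exact (le_symm_comm.1 this).trans symm_one.le
    · rw [RLAlg.dist_mk_mk]
      exact (hr n).contra
  tfae_have 3 → 1 := by
    rintro ⟨ψ, hanti, hglb, hψ⟩
    have hF : Antitone fun n => (ψ n).toFun := RLAlg.toFun_mono.comp_antitone hanti
    -- Dini's theorem is applied to the real-valued functions.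
    have hFr : Antitone fun n x => ((ψ n).toFun x : ℝ) := fun m n h x => hF h x
    have hdini := hFr.tendstoUniformly_of_forall_tendsto
      (fun n => continuous_subtype_val.comp (ψ n).continuous_toFun)
      (continuous_const (y := ((0 : I) : ℝ))) fun x =>
        (continuous_subtype_val.tendsto _).comp (tendsto_atTop_isGLB (fun m n h => hF h x) (hglb x))
    rw [Metric.tendstoUniformly_iff] at hdini ⊢
    intro ε hε
    filter_upwards [hdini ε hε] with n hn e
    have h1 := Subtype.coe_le_coe.2 (RLAlg.toFun_mono (hψ n) e)
    rw [RLAlg.dist_mk_mk] at h1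
    have h2 : ((RLAlg.compl (RLAlg.mk (biimp φ (φs n)))).toFun e : ℝ) =
        1 - RLForm.eval e (biimp φ (φs n)) := rfl
    rw [h2, coe_eval_biimp] at h1
    have h3 : |((0 : I) : ℝ) - (ψ n).toFun e| < ε := hn e
    rw [Subtype.dist_eq, Real.dist_eq]
    rw [Set.Icc.coe_zero, zero_sub, abs_neg, abs_of_nonneg ((ψ n).toFun e).2.1] at h3
    simp only [termFun]
    linarith
  tfae_finish
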